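/- Let $(M,g)$ be a smooth Lorentzian manifold of dimension $n\ge 2$ and signature $(-,+,\dots,+)$, with Levi-Civita connection $\nabla$, and let $k$ be a smooth nowhere-vanishing null vector field on $M$. A null frame aligned with $k$ on an open set $U\subseteq M$ is a tuple of smooth vector fields $(m_{(0)},m_{(1)},m_{(2)},\dots,m_{(n-1)})=(\ell,\mathbf n,m_{(2)},\dots,m_{(n-1)})$ on $U$, with $\ell$ proportional to $k$, such that $g(\ell,\mathbf n)=1$, $g(m_{(i)},m_{(j)})=\delta_{ij}$ for $i,j\ge 2$, and all other scalar products vanish. The component $T_{a_1\dots a_p}=T(m_{(a_1)},\dots,m_{(a_p)})$ of a covariant tensor has boost weight $b=\#\{r: a_r=0\}-\#\{r: a_r=1\}$. Assume that $(M,g)$ is a degenerate Kundt spacetime with Kundt direction $k$, that is, in every null frame aligned with $k$: 1. (Kundt) the rotation coefficients $L_{ab}=\ell_{a;b}=g(\nabla_{m_{(b)}}\ell,m_{(a)})$ satisfy $L_{i0}=0$ and $L_{ij}=0$ for all $i,j\ge2$; 2. (degenerate) for every $N\ge 0$, all components of positive boost weight of the $N$-th covariant derivative $\nabla^{(N)}\mathrm{Riem}$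 of the Riemann tensor vanish. Let $(\ell,\mathbf n,m_{(2)},\dots,m_{(n-1)})$ be a null frame aligned with $k$ on an open set $U$ that is parallelly transported along $\ell$, with $\ell$ geodesic and affinely parametrized, i.e. $\nabla_\ell m_{(a)}=0$ on $U$ for all $a=0,\dots,n-1$, and let $D$ denote the derivative along $\ell$. A scalar $\eta$ of boost weight $b$ is called 1-balanced if $D^{-b-1}\eta=0$ for $b<-1$ and $\eta=0$ for $b\ge-1$; a tensor is called 1-balanced (on $U$, in this frame) if all its frame components are 1-balanced scalars. Let $T$ be a smooth tensor field of any rank $p\ge 0$, with all its indices lowered by means of $g$. If $T$ is 1-balanced, then so is its covariant derivative $\nabla T$, with components $T_{a_1\dots a_p;b}$. -/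

import Mathlib

open Bundle Set VectorField
open scoped Manifold ContDiff Topology

noncomputable section

/-- Vector fields on `M` as functions; smoothness is always required separately. -/
abbrev VField (m : ℕ) (M : Type*) [TopologicalSpace M] [ChartedSpace (EuclideanSpace ℝ (Fin (m + 2))) M] :
    Type _ :=
  Π x : M, TangentSpace (𝓡 (m + 2)) x

/-- The vector field `X` is differentiable at `x`. -/
abbrev VDiffAt {m : ℕ} {M : Type*} [TopologicalSpace M]
    [ChartedSpace (EuclideanSpace ℝ (Fin (m + 2))) M] [IsManifold (𝓡 (m + 2)) ∞ M]
    (X : VField m M) (x : M) : Prop :=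
  MDifferentiableAt (𝓡 (m + 2)) ((𝓡 (m + 2)).prod 𝓘(ℝ, EuclideanSpace ℝ (Fin (m + 2))))
    (fun y ↦ TotalSpace.mk' (EuclideanSpace ℝ (Fin (m + 2)))
      (E := (TangentSpace (𝓡 (m + 2)) : M → Type _)) y (X y)) x

/-- A smooth Lorentzian metric, of signature `(-, +, …, +)`. -/
structure LorentzMetric (m : ℕ) (M : Type*) [TopologicalSpace M]
    [ChartedSpace (EuclideanSpace ℝ (Fin (m + 2))) M] [IsManifold (𝓡 (m + 2)) ∞ M] where
  /-- The scalar product on each tangent space. -/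
  val (x : M) : TangentSpace (𝓡 (m + 2)) x →L[ℝ] TangentSpace (𝓡 (m + 2)) x →L[ℝ] ℝ
  symm (x : M) (v w : TangentSpace (𝓡 (m + 2)) x) : val x v w = val x w v
  lorentzian (x : M) : ∃ b : Module.Basis (Fin (m + 2)) ℝ (TangentSpace (𝓡 (m + 2)) x),
    ∀ i j, val x (b i) (b j) = if i = j then (if i = 0 then -1 else 1) else 0
  contMDiff : ContMDiff (𝓡 (m + 2))
    ((𝓡 (m + 2)).prod 𝓘(ℝ, EuclideanSpace ℝ (Fin (m + 2)) →L[ℝ] EuclideanSpace ℝ (Fin (m + 2)) →L[ℝ] ℝ)) ∞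
    (fun x ↦ TotalSpace.mk' (EuclideanSpace ℝ (Fin (m + 2)) →L[ℝ] EuclideanSpace ℝ (Fin (m + 2)) →L[ℝ] ℝ)
      (E := fun x : M ↦ TangentSpace (𝓡 (m + 2)) x →L[ℝ] TangentSpace (𝓡 (m + 2)) x →L[ℝ] ℝ)
      x (val x))

namespace LorentzMetric

variable {m : ℕ} {M : Type*} [TopologicalSpace M] [ChartedSpace (EuclideanSpace ℝ (Fin (m + 2))) M]
  [IsManifold (𝓡 (m + 2)) ∞ M] (g : LorentzMetric m M)

/-- The function `g(X, Y)`. -/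
def pair (X Y : VField m M) : M → ℝ := fun x ↦ g.val x (X x) (Y x)

lemma pair_comm (X Y : VField m M) : g.pair X Y = g.pair Y X :=
  funext fun x ↦ g.symm x _ _

lemma mdifferentiableAt_pair {X Y : VField m M} {x : M} (hX : VDiffAt X x)
    (hY : VDiffAt Y x) : MDifferentiableAt (𝓡 (m + 2)) 𝓘(ℝ, ℝ) (g.pair X Y) x := by
  have hg := (g.contMDiff x).mdifferentiableAt (by simp)
  have := MDifferentiableAt.clm_bundle_apply₂ (F₁ := EuclideanSpace ℝ (Fin (m + 2))) (F₂ := EuclideanSpace ℝ (Fin (m + 2)))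
    (F₃ := ℝ) (E₃ := fun _ : M ↦ ℝ) hg hX hY
  simpa [mdifferentiableAt_section] using! this

/-! ### Raising an index -/

/-- A pseudo-orthonormal basis of the tangent space at `x`. -/
def orthoBasis (x : M) : Module.Basis (Fin (m + 2)) ℝ (TangentSpace (𝓡 (m + 2)) x) :=
  (g.lorentzian x).choose

lemma orthoBasis_spec (x : M) (i j : Fin (m + 2)) :
    g.val x (g.orthoBasis x i) (g.orthoBasis x j) =
      if i = j then (if i = 0 then -1 else 1) else 0 :=
  (g.lorentzian x).choose_spec i j

/-- The vector metrically equivalent to a covector. -/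
def raise (x : M) :
    (TangentSpace (𝓡 (m + 2)) x →L[ℝ] ℝ) →ₗ[ℝ] TangentSpace (𝓡 (m + 2)) x where
  toFun φ := ∑ i, ((if i = 0 then (-1 : ℝ) else 1) * φ (g.orthoBasis x i)) • g.orthoBasis x i
  map_add' φ ψ := by simp [mul_add, add_smul, Finset.sum_add_distrib]
  map_smul' c φ := by
    rw [Finset.smul_sum]
    refine Finset.sum_congr rfl fun i _ ↦ ?_
    rw [smul_smul, smul_apply, smul_eq_mul, RingHom.id_apply]
    ring_nf

lemma val_raise (x : M) (φ : TangentSpace (𝓡 (m + 2)) x →L[ℝ] ℝ)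
    (w : TangentSpace (𝓡 (m + 2)) x) : g.val x (g.raise x φ) w = φ w := by
  have key : (g.val x (g.raise x φ) : TangentSpace (𝓡 (m + 2)) x →ₗ[ℝ] ℝ) = φ := by
    refine (g.orthoBasis x).ext fun j ↦ ?_
    simp only [raise, LinearMap.coe_mk, AddHom.coe_mk, ContinuousLinearMap.coe_coe,
      sum_apply, map_sum, map_smul, smul_apply, orthoBasis_spec, smul_eq_mul]
    rw [Finset.sum_eq_single j]
    · by_cases hj : j = 0 <;> simp [hj]
    · intro i _ hij
      simp [hij]
    · simp
  exact congrArg (fun f : TangentSpace (𝓡 (m + 2)) x →ₗ[ℝ] ℝ ↦ f w) key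

lemma raise_val (x : M) (v : TangentSpace (𝓡 (m + 2)) x) : g.raise x (g.val x v) = v := by
  have h0 : ∀ u : TangentSpace (𝓡 (m + 2)) x, (∀ w, g.val x u w = 0) → u = 0 := by
    intro u hu
    refine (g.orthoBasis x).ext_elem fun j ↦ ?_
    have h1 := hu (g.orthoBasis x j)
    rw [← (g.orthoBasis x).sum_repr u] at h1
    simp only [map_sum, map_smul, sum_apply, smul_apply,
      orthoBasis_spec, smul_eq_mul] at h1
    rw [Finset.sum_eq_single j] at h1
    · by_cases hj : j = 0 <;> simpa [hj] using h1
    · intro i _ hij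
      simp [hij]
    · simp
  rw [← sub_eq_zero]
  refine h0 _ fun w ↦ ?_
  rw [map_sub, sub_apply, val_raise, sub_self]

lemma ext_val {x : M} {v w : TangentSpace (𝓡 (m + 2)) x} (h : ∀ u, g.val x v u = g.val x w u) :
    v = w := by
  rw [← g.raise_val x v, ← g.raise_val x w]
  congr 1
  ext u
  exact h u

/-! ### The Levi-Civita connection -/

/-- The right-hand side of the Koszul formula for `g(∇_X Y, Z)`. -/
def koszul (Y X Z : VField m M) (x : M) : ℝ :=
  (mvfderiv (𝓡 (m + 2)) (g.pair Y Z) x (X x) + mvfderiv (𝓡 (m + 2)) (g.pair X Z) x (Y x) - mvfderiv (𝓡 (m + 2)) (g.pair X Y) x (Z x)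
    + g.val x (mlieBracket (𝓡 (m + 2)) X Y x) (Z x)
    - g.val x (mlieBracket (𝓡 (m + 2)) X Z x) (Y x)
    - g.val x (mlieBracket (𝓡 (m + 2)) Y Z x) (X x)) / 2

lemma pair_add_left (X X' Y : VField m M) : g.pair (X + X') Y = g.pair X Y + g.pair X' Y := by
  ext x; simp [pair]

lemma pair_add_right (X Y Y' : VField m M) : g.pair X (Y + Y') = g.pair X Y + g.pair X Y' := by
  ext x; simp [pair]

lemma pair_smul_left (f : M → ℝ) (X Y : VField m M) : g.pair (f • X) Y = f * g.pair X Y := by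
  ext x; simp [pair]

lemma pair_smul_right (f : M → ℝ) (X Y : VField m M) : g.pair X (f • Y) = f * g.pair X Y := by
  ext x; simp [pair]

lemma tensorialAt_koszul_left {Y Z : VField m M} {x : M} (hY : VDiffAt Y x)
    (hZ : VDiffAt Z x) :
    TensorialAt (𝓡 (m + 2)) (EuclideanSpace ℝ (Fin (m + 2))) (fun X ↦ g.koszul Y X Z x) x where
  smul {f X} hf hX := by
    have h1 := g.mdifferentiableAt_pair hX hZ
    have h2 := g.mdifferentiableAt_pair hX hY
    simp only [koszul, pair_smul_left, mlieBracket_smul_left hf hX, mvfderiv_mul hf h1,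
      mvfderiv_mul hf h2]
    simp [pair]
    ring
  add {X X'} hX hX' := by
    simp only [koszul, pair_add_left, mlieBracket_add_left hX hX',
      mvfderiv_add (g.mdifferentiableAt_pair hX hZ) (g.mdifferentiableAt_pair hX' hZ),
      mvfderiv_add (g.mdifferentiableAt_pair hX hY) (g.mdifferentiableAt_pair hX' hY)]
    simp
    ring

lemma tensorialAt_koszul_right {Y X : VField m M} {x : M} (hY : VDiffAt Y x)
    (hX : VDiffAt X x) :
    TensorialAt (𝓡 (m + 2)) (EuclideanSpace ℝ (Fin (m + 2))) (fun Z ↦ g.koszul Y X Z x) x where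
  smul {f Z} hf hZ := by
    simp only [koszul, pair_smul_right, mlieBracket_smul_right hf hZ,
      mvfderiv_mul hf (g.mdifferentiableAt_pair hX hZ),
      mvfderiv_mul hf (g.mdifferentiableAt_pair hY hZ)]
    simp [pair]
    rw [g.symm x (Z x) (Y x), g.symm x (Z x) (X x)]
    ring
  add {Z Z'} hZ hZ' := by
    simp only [koszul, pair_add_right, mlieBracket_add_right hZ hZ',
      mvfderiv_add (g.mdifferentiableAt_pair hX hZ) (g.mdifferentiableAt_pair hX hZ'),
      mvfderiv_add (g.mdifferentiableAt_pair hY hZ) (g.mdifferentiableAt_pair hY hZ')]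
    simp
    ring

instance instFiniteDimensionalTangent (x : M) : FiniteDimensional ℝ (TangentSpace (𝓡 (m + 2)) x) :=
  inferInstanceAs (FiniteDimensional ℝ (EuclideanSpace ℝ (Fin (m + 2))))

instance instT2SpaceTangent (x : M) : T2Space (TangentSpace (𝓡 (m + 2)) x) :=
  inferInstanceAs (T2Space (EuclideanSpace ℝ (Fin (m + 2))))

open Classical in
/-- `v ↦ ∇_v Y` at `x`, given by the Koszul formula (and `0` where `Y` is not differentiable). -/
def leviCivitaFun (Y : VField m M) (x : M) :
    TangentSpace (𝓡 (m + 2)) x →L[ℝ] TangentSpace (𝓡 (m + 2)) x :=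
  if hY : VDiffAt Y x then
    LinearMap.toContinuousLinearMap ((g.raise x).comp (TensorialAt.mkHom₂
      (fun X Z ↦ g.koszul Y X Z x) x (fun _ hZ ↦ g.tensorialAt_koszul_left hY hZ)
      (fun _ hX ↦ g.tensorialAt_koszul_right hY hX)).toLinearMap)
  else 0

lemma val_leviCivitaFun {X Y Z : VField m M} {x : M} (hX : VDiffAt X x)
    (hY : VDiffAt Y x) (hZ : VDiffAt Z x) :
    g.val x (g.leviCivitaFun Y x (X x)) (Z x) = g.koszul Y X Z x := by
  rw [leviCivitaFun, dif_pos hY, LinearMap.coe_toContinuousLinearMap', LinearMap.comp_apply,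
    val_raise, ContinuousLinearMap.coe_coe, TensorialAt.mkHom₂_apply _ _ hX hZ]

lemma leviCivitaFun_ext {x : M} {A B : TangentSpace (𝓡 (m + 2)) x →L[ℝ]
    TangentSpace (𝓡 (m + 2)) x}
    (h : ∀ X Z : VField m M, VDiffAt X x → VDiffAt Z x →
      g.val x (A (X x)) (Z x) = g.val x (B (X x)) (Z x)) : A = B := by
  ext1 v
  refine g.ext_val fun w ↦ ?_
  simpa using h (FiberBundle.extend (EuclideanSpace ℝ (Fin (m + 2))) v)
    (FiberBundle.extend (EuclideanSpace ℝ (Fin (m + 2))) w) (FiberBundle.mdifferentiableAt_extend ..)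
    (FiberBundle.mdifferentiableAt_extend ..)

/-- The Levi-Civita connection of `g`. -/
def leviCivita :
    CovariantDerivative (𝓡 (m + 2)) (EuclideanSpace ℝ (Fin (m + 2)))
      (TangentSpace (𝓡 (m + 2)) : M → Type _) where
  toFun := g.leviCivitaFun
  isCovariantDerivativeOnUniv :=
    { add := by
        intro Y Y' x hY hY' _
        refine g.leviCivitaFun_ext fun X Z hX hZ ↦ ?_
        have hs : VDiffAt (Y + Y') x := mdifferentiableAt_add_section hY hY'
        rw [g.val_leviCivitaFun hX hs hZ, add_apply, map_add,
          add_apply, g.val_leviCivitaFun hX hY hZ,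
          g.val_leviCivitaFun hX hY' hZ]
        simp only [koszul, pair_add_left, pair_add_right, mlieBracket_add_left hY hY',
          mlieBracket_add_right hY hY',
          mvfderiv_add (g.mdifferentiableAt_pair hY hZ) (g.mdifferentiableAt_pair hY' hZ),
          mvfderiv_add (g.mdifferentiableAt_pair hX hY) (g.mdifferentiableAt_pair hX hY')]
        simp
        ring
      leibniz := by
        intro Y f x hY hf _
        refine g.leviCivitaFun_ext fun X Z hX hZ ↦ ?_
        have hs : VDiffAt (f • Y) x := hf.smul_section hY
        rw [g.val_leviCivitaFun hX hs hZ, add_apply, map_add,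
          add_apply, smul_apply, map_smul,
          smul_apply, g.val_leviCivitaFun hX hY hZ]
        simp only [koszul, pair_smul_left, pair_smul_right, mlieBracket_smul_left hf hY,
          mlieBracket_smul_right hf hY, mvfderiv_mul hf (g.mdifferentiableAt_pair hY hZ),
          mvfderiv_mul hf (g.mdifferentiableAt_pair hX hY)]
        simp [pair]
        rw [g.symm x (Y x) (X x)]
        ring }

lemma val_leviCivita {X Y Z : VField m M} {x : M} (hX : VDiffAt X x)
    (hY : VDiffAt Y x) (hZ : VDiffAt Z x) :
    g.val x (g.leviCivita Y x (X x)) (Z x) = g.koszul Y X Z x :=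
  g.val_leviCivitaFun hX hY hZ

/-- The Levi-Civita connection is torsion-free. -/
theorem leviCivita_torsion : g.leviCivita.torsion = 0 := by
  rw [CovariantDerivative.torsion_eq_zero_iff]
  intro X Y x hX hY
  refine g.ext_val fun w ↦ ?_
  have hW : VDiffAt (FiberBundle.extend (EuclideanSpace ℝ (Fin (m + 2))) w) x :=
    FiberBundle.mdifferentiableAt_extend ..
  have hw : FiberBundle.extend (EuclideanSpace ℝ (Fin (m + 2))) w x = w := by simp
  rw [← hw, map_sub, sub_apply, g.val_leviCivita hX hY hW,
    g.val_leviCivita hY hX hW]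
  simp only [koszul, g.pair_comm Y X]
  rw [mlieBracket_swap_apply (V := Y) (W := X)]
  simp
  ring

/-- The Levi-Civita connection is compatible with the metric. -/
theorem leviCivita_metric {X Y Z : VField m M} {x : M} (hX : VDiffAt X x)
    (hY : VDiffAt Y x) (hZ : VDiffAt Z x) :
    mvfderiv (𝓡 (m + 2)) (g.pair Y Z) x (X x) =
      g.val x (g.leviCivita Y x (X x)) (Z x) + g.val x (Y x) (g.leviCivita Z x (X x)) := by
  rw [g.symm x (Y x), g.val_leviCivita hX hY hZ, g.val_leviCivita hX hZ hY]
  simp only [koszul, g.pair_comm Z Y]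
  rw [mlieBracket_swap_apply (V := Z) (W := Y)]
  simp
  ring

/-- The vector field `∇_X Y`. -/
def nabla (X Y : VField m M) : VField m M := fun x ↦ g.leviCivita Y x (X x)

end LorentzMetric

/-! ### Tensor fields -/

section Tensors

variable {m : ℕ} {M : Type*} [TopologicalSpace M] [ChartedSpace (EuclideanSpace ℝ (Fin (m + 2))) M]
  [IsManifold (𝓡 (m + 2)) ∞ M]

/-- The vector field `X` is smooth on `U`. -/
def VSmoothOn (X : VField m M) (U : Set M) : Prop :=
  ContMDiffOn (𝓡 (m + 2)) ((𝓡 (m + 2)).prod 𝓘(ℝ, EuclideanSpace ℝ (Fin (m + 2)))) ∞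
    (fun y ↦ TotalSpace.mk' (EuclideanSpace ℝ (Fin (m + 2)))
      (E := (TangentSpace (𝓡 (m + 2)) : M → Type _)) y (X y)) U

/-- Covariant rank-`k` tensor fields are handled as operations taking `k` vector fields to a
function; only the values on fields that are smooth near a point matter there. -/
abbrev TensorOp (m : ℕ) (M : Type*) [TopologicalSpace M]
    [ChartedSpace (EuclideanSpace ℝ (Fin (m + 2))) M] (k : ℕ) : Type _ :=
  (Fin k → VField m M) → M → ℝ

/-- `T` is a smooth covariant tensor field: on smooth (possibly only locally defined) vector fields
it is evaluation of a multilinear form on each tangent space, and the result is smooth. -/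
structure IsTensorField {k : ℕ} (T : TensorOp m M k) : Prop where
  pointwise (x : M) : ∃ t : MultilinearMap ℝ (fun _ : Fin k ↦ TangentSpace (𝓡 (m + 2)) x) ℝ,
    ∀ (U : Set M) (X : Fin k → VField m M), IsOpen U → x ∈ U → (∀ i, VSmoothOn (X i) U) →
      T X x = t (fun i ↦ X i x)
  smooth (U : Set M) (X : Fin k → VField m M) : IsOpen U → (∀ i, VSmoothOn (X i) U) →
    ContMDiffOn (𝓡 (m + 2)) 𝓘(ℝ, ℝ) ∞ (T X) U

namespace LorentzMetric

variable (g : LorentzMetric m M)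

/-- The covariant derivative of a tensor field, the new (derivative) slot being the last one:
`(∇T)(X₁, …, X_k, Y) = Y (T(X₁, …, X_k)) - ∑ i, T(X₁, …, ∇_Y X_i, …, X_k)`. -/
def covDeriv {k : ℕ} (T : TensorOp m M k) : TensorOp m M (k + 1) := fun X x ↦
  mvfderiv (𝓡 (m + 2)) (T (fun i ↦ X i.castSucc)) x (X (Fin.last k) x)
    - ∑ i : Fin k, T (Function.update (fun j : Fin k ↦ X j.castSucc) i
        (g.nabla (X (Fin.last k)) (X i.castSucc))) x

/-- The curvature operator `R(X, Y) Z = ∇_X ∇_Y Z - ∇_Y ∇_X Z - ∇_[X, Y] Z`. -/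
def curvature (X Y Z : VField m M) : VField m M :=
  g.nabla X (g.nabla Y Z) - g.nabla Y (g.nabla X Z) - g.nabla (mlieBracket (𝓡 (m + 2)) X Y) Z

/-- The Riemann tensor as a covariant tensor of rank four. -/
def riem : TensorOp m M 4 := fun X ↦ g.pair (g.curvature (X 0) (X 1) (X 2)) (X 3)

/-- The `N`-th covariant derivative of the Riemann tensor. -/
def riemDeriv : (N : ℕ) → TensorOp m M (4 + N)
  | 0 => g.riem
  | N + 1 => g.covDeriv (riemDeriv N)

/-! ### Null frames and boost weight -/

/-- `(e 0, e 1, e 2, …) = (ℓ, n, m⁽²⁾, …)` is a smooth null frame on the open set `U` whose first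
vector spans the null direction of `k`: `ℓ` and `n` are null with `g(ℓ, n) = 1`, and the remaining
vectors are orthonormal and orthogonal to `ℓ` and `n`. -/
structure IsNullFrameOn (k : VField m M) (U : Set M) (e : Fin (m + 2) → VField m M) : Prop where
  isOpen : IsOpen U
  smooth (a : Fin (m + 2)) : VSmoothOn (e a) U
  gram (a b : Fin (m + 2)) : ∀ x ∈ U, g.val x (e a x) (e b x) =
    if a = 0 then (if b = 1 then 1 else 0)
    else if a = 1 then (if b = 0 then 1 else 0)
    else if a = b then 1 else 0
  aligned : ∀ x ∈ U, ∃ c : ℝ, e 0 x = c • k x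

/-- A null frame that is parallelly transported along its first vector `ℓ`; for `a = 0` the
condition says that `ℓ` is geodesic and affinely parametrized. -/
structure IsParallelNullFrameOn (k : VField m M) (U : Set M) (e : Fin (m + 2) → VField m M) : Prop
    extends g.IsNullFrameOn k U e where
  parallel (a : Fin (m + 2)) : ∀ x ∈ U, g.nabla (e 0) (e a) x = 0

/-- The Ricci rotation coefficient `L_{ab} = ℓ_{a;b}`, where `ℓ = e 0`. -/
def rotL (e : Fin (m + 2) → VField m M) (a b : Fin (m + 2)) : M → ℝ :=
  g.pair (g.nabla (e b) (e 0)) (e a)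

end LorentzMetric

/-- The boost weight of the frame component with indices `a₁, …, a_k` of a covariant tensor: the
number of indices `0` minus the number of indices `1`. -/
def boostWeight {k : ℕ} (a : Fin k → Fin (m + 2)) : ℤ :=
  ∑ j, if a j = 0 then 1 else if a j = 1 then -1 else 0

/-- The frame component `T(e_{a₁}, …, e_{a_k})`. -/
def frameComponent {k : ℕ} (T : TensorOp m M k) (e : Fin (m + 2) → VField m M)
    (a : Fin k → Fin (m + 2)) : M → ℝ :=
  T (fun j ↦ e (a j))

namespace LorentzMetric

variable (g : LorentzMetric m M)

/-! ### Degenerate Kundt spacetimes -/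

/-- `g` is a Kundt metric with Kundt vector field `k`: a (nowhere zero) null vector field such that
`L_{i0} = 0 = L_{ij}` in the null frames with `ℓ` along `k` (this is invariant under rescaling). -/
structure IsKundt (k : VField m M) : Prop where
  smooth : VSmoothOn k univ
  ne_zero (x : M) : k x ≠ 0
  null (x : M) : g.val x (k x) (k x) = 0
  rot_zero (U : Set M) (e : Fin (m + 2) → VField m M) : g.IsNullFrameOn k U e →
    ∀ i : Fin m, ∀ x ∈ U, g.rotL e i.succ.succ 0 x = 0
  rot_spatial (U : Set M) (e : Fin (m + 2) → VField m M) : g.IsNullFrameOn k U e →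
    ∀ i j : Fin m, ∀ x ∈ U, g.rotL e i.succ.succ j.succ.succ x = 0

/-- A Kundt metric is degenerate if the Kundt direction is a multiple null direction of the Riemann
tensor and of all its covariant derivatives, i.e. all of them are of aligned type II or more
special: their frame components of positive boost weight vanish. -/
structure IsDegenerateKundt (k : VField m M) : Prop extends g.IsKundt k where
  typeII (N : ℕ) (U : Set M) (e : Fin (m + 2) → VField m M) : g.IsNullFrameOn k U e →
    ∀ a : Fin (4 + N) → Fin (m + 2), 0 < boostWeight a →
      ∀ x ∈ U, frameComponent (g.riemDeriv N) e a x = 0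

end LorentzMetric

/-! ### 1-balanced scalars and tensors -/

/-- The derivative of functions along the vector field `ℓ`. -/
def derivAlong (ℓ : VField m M) (η : M → ℝ) : M → ℝ := fun x ↦ mvfderiv (𝓡 (m + 2)) η x (ℓ x)

/-- The scalar `η` of boost weight `b` is 1-balanced on `U`, with `D` the derivative along `ℓ`. -/
structure IsOneBalancedScalarOn (U : Set M) (ℓ : VField m M) (b : ℤ) (η : M → ℝ) : Prop where
  of_lt : b < -1 → ∀ x ∈ U, (derivAlong ℓ)^[(-b - 1).toNat] η x = 0
  of_ge : -1 ≤ b → ∀ x ∈ U, η x = 0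

/-- All components of `T` in the frame `e` on `U` are 1-balanced scalars. -/
def IsOneBalancedOn (U : Set M) (e : Fin (m + 2) → VField m M) {k : ℕ} (T : TensorOp m M k) :
    Prop :=
  ∀ a : Fin k → Fin (m + 2),
    IsOneBalancedScalarOn U (e 0) (boostWeight a) (frameComponent T e a)

end Tensors

end

/-! Along `ℓ` everything behaves like a polynomial in the affine parameter: `NilAlong U ℓ d f` reads
"degree less than `d`". A scalar of boost weight `b` is 1-balanced exactly when its degree is less
than `-b - 1`, read as vanishing if that number is not positive (`isOneBalancedScalarOn_iff`).

The geometric input is a bound on the connection coefficients: at weight `w` their degree is at most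
`-w`, and they vanish for `w ≥ 1` (`nilAlong_connCoeff`). In a parallel frame `D^N` of a curvature
component is a component of `∇^N Riem` with weight raised by `N`, so degeneracy makes curvature
components nilpotent under `D`. The structure equation `DΓ = R - ΓΓ` then integrates to the bound,
because the Kundt condition removes almost all quadratic terms.

The commutator `[ℓ, e_b]` turns the bound into a rule for derivatives: `e_b` raises the permitted
degree by minus the weight of `b` (`nilAlong_derivAlong`). Each component of `∇T` is such a
derivative minus products `Γ T`; degrees add under multiplication, and both kinds of term meet the
bound required at their weight. -/

set_option linter.unusedSectionVars false

noncomputable section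

/-! ### Smooth functions, directional derivatives and brackets on open sets. -/

section Calculus

variable {m : ℕ} {M : Type*} [TopologicalSpace M] [ChartedSpace (EuclideanSpace ℝ (Fin (m + 2))) M]
  [IsManifold (𝓡 (m + 2)) ∞ M]

/-- The real function `f` is smooth on `U`. -/
abbrev FSmoothOn (m : ℕ) {M : Type*} [TopologicalSpace M]
    [ChartedSpace (EuclideanSpace ℝ (Fin (m + 2))) M] (f : M → ℝ) (U : Set M) : Prop :=
  ContMDiffOn (𝓡 (m + 2)) 𝓘(ℝ, ℝ) ∞ f U

variable {U : Set M} {x : M} {X Y Z : VField m M} {f h : M → ℝ}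

lemma VSmoothOn.vDiffAt (hX : VSmoothOn X U) (hU : IsOpen U) (hx : x ∈ U) : VDiffAt X x :=
  ((hX x hx).contMDiffAt (hU.mem_nhds hx)).mdifferentiableAt (by simp)

lemma FSmoothOn.mdiffAt (hf : FSmoothOn m f U) (hU : IsOpen U) (hx : x ∈ U) :
    MDifferentiableAt (𝓡 (m + 2)) 𝓘(ℝ, ℝ) f x :=
  ((hf x hx).contMDiffAt (hU.mem_nhds hx)).mdifferentiableAt (by simp)

lemma FSmoothOn.derivAlong (hf : FSmoothOn m f U) (hX : VSmoothOn X U) (hU : IsOpen U) :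
    FSmoothOn m (derivAlong X f) U := by
  have h1 := hf.contMDiffOn_tangentMapWithin (m := ∞) (by simp) hU.uniqueMDiffOn
  have h2 := h1.comp hX (fun y hy ↦ hy)
  have h3 := (contMDiff_snd_tangentBundle_modelSpace ℝ 𝓘(ℝ, ℝ) (n := ∞)).comp_contMDiffOn h2
  refine h3.congr fun y hy ↦ ?_
  simp only [Function.comp, tangentMapWithin, mfderivWithin_of_isOpen hU hy]
  rfl

lemma VSmoothOn.mlieBracket (hX : VSmoothOn X U) (hY : VSmoothOn Y U) (hU : IsOpen U) :
    VSmoothOn (mlieBracket (𝓡 (m + 2)) X Y) U := fun x hx ↦ by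
  have : IsManifold (𝓡 (m + 2)) (minSmoothness ℝ 3) M := by
    simpa using IsManifold.of_le (m := 3) (n := ∞) ENat.LEInfty.out
  have : IsManifold (𝓡 (m + 2)) ((⊤ : ℕ∞) + 1) M := by simpa
  exact (ContMDiffAt.mlieBracket_vectorField (m := ⊤) (n := ⊤)
    ((hX x hx).contMDiffAt (hU.mem_nhds hx))
    ((hY x hx).contMDiffAt (hU.mem_nhds hx)) (by simp)).contMDiffWithinAt

lemma derivAlong_congr {f f' : M → ℝ} (hU : IsOpen U) (h : ∀ y ∈ U, f y = f' y) (hx : x ∈ U) :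
    derivAlong X f x = derivAlong X f' x := by
  have : f =ᶠ[𝓝 x] f' := Filter.eventually_of_mem (hU.mem_nhds hx) h
  simp only [derivAlong, mvfderiv, this.mfderiv_eq]
  rfl

lemma derivAlong_eq_zero (hU : IsOpen U) (h : ∀ y ∈ U, f y = 0) (hx : x ∈ U) :
    derivAlong X f x = 0 := by
  rw [derivAlong_congr (f' := 0) hU (by simpa using h) hx]
  simp [derivAlong]

lemma derivAlong_iterate_congr {f f' : M → ℝ} (hU : IsOpen U) (h : ∀ y ∈ U, f y = f' y) (n : ℕ) :
    ∀ x ∈ U, (derivAlong X)^[n] f x = (derivAlong X)^[n] f' x := by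
  induction n generalizing f f' with
  | zero => exact h
  | succ n ih => exact ih fun y hy ↦ derivAlong_congr hU h hy

/-- On functions, the Lie bracket of vector fields is their commutator. -/
lemma derivAlong_mlieBracket (hU : IsOpen U) (hX : VSmoothOn X U) (hY : VSmoothOn Y U)
    (hZ : VSmoothOn Z U) (hf : FSmoothOn m f U) (hx : x ∈ U) (hZx : Z x ≠ 0) :
    derivAlong (mlieBracket (𝓡 (m + 2)) X Y) f x =
      derivAlong X (derivAlong Y f) x - derivAlong Y (derivAlong X f) x := by
  have : IsManifold (𝓡 (m + 2)) (minSmoothness ℝ 3) M := by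
    simpa using IsManifold.of_le (m := 3) (n := ∞) ENat.LEInfty.out
  have two (W : VField m M) (hW : VSmoothOn W U) := ((hW x hx).contMDiffAt (hU.mem_nhds hx)).of_le
    (show minSmoothness ℝ 2 ≤ ∞ by simpa using ENat.LEInfty.out)
  -- The Jacobi identity for `X`, `Y`, `f • Z` carries the commutator formula in its `Z x`
  -- coefficient: the mixed first-order terms cancel in the antisymmetrization, and the terms with
  -- factor `f` cancel by Jacobi for `X`, `Y`, `Z`.
  have ev (V : VField m M) (hV : VSmoothOn V U) :
      mlieBracket (𝓡 (m + 2)) V (f • Z) =ᶠ[𝓝 x]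
        derivAlong V f • Z + f • mlieBracket (𝓡 (m + 2)) V Z :=
    Filter.eventually_of_mem (hU.mem_nhds hx) fun y hy ↦ by
      rw [mlieBracket_smul_right (hf.mdiffAt hU hy) (hZ.vDiffAt hU hy)]; rfl
  have key (V W : VField m M) (hV : VSmoothOn V U) (hW : VSmoothOn W U) :
      mlieBracket (𝓡 (m + 2)) V (mlieBracket (𝓡 (m + 2)) W (f • Z)) x =
        derivAlong V (derivAlong W f) x • Z x + derivAlong W f x • mlieBracket (𝓡 (m + 2)) V Z x
        + (derivAlong V f x • mlieBracket (𝓡 (m + 2)) W Z x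
        + f x • mlieBracket (𝓡 (m + 2)) V (mlieBracket (𝓡 (m + 2)) W Z) x) := by
    have hWf := (hf.derivAlong hW hU).mdiffAt hU hx
    have hWZ := (hW.mlieBracket hZ hU).vDiffAt hU hx
    rw [(Filter.EventuallyEq.refl _ V).mlieBracket_vectorField_eq (ev W hW),
      mlieBracket_add_right (hWf.smul_section (hZ.vDiffAt hU hx))
        ((hf.mdiffAt hU hx).smul_section hWZ),
      mlieBracket_smul_right hWf (hZ.vDiffAt hU hx),
      mlieBracket_smul_right (hf.mdiffAt hU hx) hWZ]
    rfl
  have J := leibniz_identity_mlieBracket_apply (two X hX) (two Y hY)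
    (two (f • Z) (hf.smul_section hZ))
  have J' := leibniz_identity_mlieBracket_apply (two X hX) (two Y hY) (two Z hZ)
  rw [key X Y hX hY, key Y X hY hX, J', (ev _ (hX.mlieBracket hY hU)).self_of_nhds] at J
  have : (derivAlong (mlieBracket (𝓡 (m + 2)) X Y) f x -
      (derivAlong X (derivAlong Y f) x - derivAlong Y (derivAlong X f) x)) • Z x = 0 := by
    simp only [Pi.add_apply, Pi.smul_apply', smul_add] at J
    rw [sub_smul, sub_smul]
    linear_combination (norm := module) -J
  exact sub_eq_zero.1 ((smul_eq_zero.1 this).resolve_right hZx)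

/-- The function `f` is smooth on `U`, where its `d`-th derivative along `ℓ` vanishes. -/
structure NilAlong (U : Set M) (ℓ : VField m M) (d : ℕ) (f : M → ℝ) : Prop where
  smooth : FSmoothOn m f U
  eq_zero : ∀ x ∈ U, (derivAlong ℓ)^[d] f x = 0

/-! ### Calculus of functions that are polynomial along `ℓ`. -/

namespace NilAlong

variable {ℓ : VField m M} {d d' : ℕ}

lemma of_eq_zero (hU : IsOpen U) (h : ∀ x ∈ U, f x = 0) : NilAlong U ℓ d f where
  smooth := (contMDiffOn_const (c := (0 : ℝ))).congr h
  eq_zero := by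
    induction d generalizing f with
    | zero => exact h
    | succ d ih => exact ih fun y hy ↦ derivAlong_eq_zero hU h hy

lemma congr (hf : NilAlong U ℓ d f) (hU : IsOpen U) (h' : ∀ x ∈ U, h x = f x) :
    NilAlong U ℓ d h :=
  ⟨hf.smooth.congr h', fun x hx ↦ by rw [derivAlong_iterate_congr hU h' d x hx, hf.eq_zero x hx]⟩

lemma succ_iff (hU : IsOpen U) (hℓ : VSmoothOn ℓ U) :
    NilAlong U ℓ (d + 1) f ↔ FSmoothOn m f U ∧ NilAlong U ℓ d (derivAlong ℓ f) :=
  ⟨fun h ↦ ⟨h.smooth, h.smooth.derivAlong hℓ hU, h.eq_zero⟩, fun h ↦ ⟨h.1, h.2.eq_zero⟩⟩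

lemma mono (hf : NilAlong U ℓ d f) (hU : IsOpen U) (h : d ≤ d') : NilAlong U ℓ d' f := by
  refine ⟨hf.smooth, fun x hx ↦ ?_⟩
  obtain ⟨k, rfl⟩ := Nat.exists_eq_add_of_le h
  rw [add_comm, Function.iterate_add_apply]
  exact (of_eq_zero hU hf.eq_zero (d := k) (ℓ := ℓ)).eq_zero x hx

lemma add (hf : NilAlong U ℓ d f) (hh : NilAlong U ℓ d h) (hU : IsOpen U)
    (hℓ : VSmoothOn ℓ U) : NilAlong U ℓ d (f + h) := by
  induction d generalizing f h with
  | zero =>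
    refine of_eq_zero hU fun x hx ↦ ?_
    simpa using congrArg₂ (· + ·) (hf.eq_zero x hx) (hh.eq_zero x hx)
  | succ d ih =>
    rw [succ_iff hU hℓ] at hf hh ⊢
    refine ⟨hf.1.add hh.1, (ih hf.2 hh.2).congr hU fun x hx ↦ ?_⟩
    simp [derivAlong, mvfderiv_add (hf.1.mdiffAt hU hx) (hh.1.mdiffAt hU hx)]

/-- Degrees at most `a` and less than `b` multiply to degree less than `a + b`. The Leibniz rule
lowers one of the two orders in each summand, so induction on their sum applies. -/
lemma mul_succ {a b : ℕ} (hf : NilAlong U ℓ (a + 1) f) (hh : NilAlong U ℓ b h) (hU : IsOpen U)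
    (hℓ : VSmoothOn ℓ U) : NilAlong U ℓ (a + b) (f * h) := by
  induction hn : a + b generalizing a b f h with
  | zero =>
    obtain rfl : b = 0 := by omega
    exact of_eq_zero hU fun x hx ↦ by simpa using Or.inr (hh.eq_zero x hx)
  | succ n ih =>
    rcases b with _ | b
    · exact of_eq_zero hU fun x hx ↦ by simpa using Or.inr (hh.eq_zero x hx)
    have hh' := (succ_iff hU hℓ).1 hh
    have hf' := (succ_iff hU hℓ).1 hf
    refine (succ_iff hU hℓ).2 ⟨hf.smooth.mul hh.smooth, ?_⟩
    have h1 : NilAlong U ℓ n (f * derivAlong ℓ h) := ih hf hh'.2 (by omega)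
    have h2 : NilAlong U ℓ n (derivAlong ℓ f * h) := by
      rcases a with _ | a
      · exact of_eq_zero hU fun x hx ↦ by simpa using Or.inl (hf'.2.eq_zero x hx)
      · exact ih hf'.2 hh (by omega)
    refine (h1.add h2 hU hℓ).congr hU fun x hx ↦ ?_
    simp [derivAlong, mvfderiv_mul (hf.smooth.mdiffAt hU hx) (hh.smooth.mdiffAt hU hx), mul_comm]

/-- Integer orders let boost weights be added without case distinctions: truncation at zero is
harmless, since a nonpositive order makes that factor, hence the product, vanish. -/
lemma mul {a b c : ℤ} (hf : NilAlong U ℓ a.toNat f) (hh : NilAlong U ℓ b.toNat h) (hU : IsOpen U)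
    (hℓ : VSmoothOn ℓ U) (hc : a + b - 1 ≤ c) : NilAlong U ℓ c.toNat (f * h) := by
  rcases le_or_gt a 0 with ha | ha
  · rw [Int.toNat_of_nonpos ha] at hf
    exact of_eq_zero hU fun x hx ↦ by simpa using Or.inl (hf.eq_zero x hx)
  rcases le_or_gt b 0 with hb | hb
  · rw [Int.toNat_of_nonpos hb] at hh
    exact of_eq_zero hU fun x hx ↦ by simpa using Or.inr (hh.eq_zero x hx)
  obtain ⟨a, rfl⟩ := Int.eq_succ_of_zero_lt ha
  exact (mul_succ (a := a) (by simpa using hf) hh hU hℓ).mono hU (by omega)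

lemma neg (hf : NilAlong U ℓ d f) (hU : IsOpen U) (hℓ : VSmoothOn ℓ U) :
    NilAlong U ℓ d (-f) := by
  induction d generalizing f with
  | zero => exact of_eq_zero hU fun x hx ↦ by simpa using hf.eq_zero x hx
  | succ d ih =>
    rw [succ_iff hU hℓ] at hf ⊢
    refine ⟨hf.1.neg, (ih hf.2).congr hU fun x hx ↦ ?_⟩
    simp [derivAlong]

lemma sub (hf : NilAlong U ℓ d f) (hh : NilAlong U ℓ d h) (hU : IsOpen U)
    (hℓ : VSmoothOn ℓ U) : NilAlong U ℓ d (f - h) := by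
  simpa [sub_eq_add_neg] using hf.add (hh.neg hU hℓ) hU hℓ

lemma sum {ι : Type*} {s : Finset ι} {f : ι → M → ℝ} (hf : ∀ i ∈ s, NilAlong U ℓ d (f i))
    (hU : IsOpen U) (hℓ : VSmoothOn ℓ U) : NilAlong U ℓ d (∑ i ∈ s, f i) :=
  Finset.sum_induction f (NilAlong U ℓ d) (fun _ _ h h' ↦ h.add h' hU hℓ)
    (of_eq_zero hU fun _ _ ↦ rfl) hf

end NilAlong

end Calculus

/-! ### Locality of the curvature and of its covariant derivatives. -/

section Locality

variable {m : ℕ} {M : Type*} [TopologicalSpace M] [ChartedSpace (EuclideanSpace ℝ (Fin (m + 2))) M]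
  [IsManifold (𝓡 (m + 2)) ∞ M] (g : LorentzMetric m M) {x : M} {X Y Z : VField m M}

namespace LorentzMetric

lemma nabla_eventually_zero_left (hX : ∀ᶠ y in 𝓝 x, X y = 0) :
    ∀ᶠ y in 𝓝 x, g.nabla X Y y = 0 := by
  filter_upwards [hX] with y hy
  simp [nabla, hy]

lemma nabla_eventually_zero_right (hY : ∀ᶠ y in 𝓝 x, Y y = 0) :
    ∀ᶠ y in 𝓝 x, g.nabla X Y y = 0 := by
  filter_upwards [hY.eventually_nhds] with y hy
  have h0 : VDiffAt (0 : VField m M) y := mdifferentiableAt_zeroSection ..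
  -- Locality of the connection is available only for differentiable fields; agreement with the zero
  -- section near `y` supplies this.
  have hYd : VDiffAt Y y := h0.congr_of_eventuallyEq (hy.mono fun z hz ↦ by simp [hz])
  rw [nabla, g.leviCivita.isCovariantDerivativeOnUniv.congr_of_eventuallyEq hYd h0
    Filter.univ_mem hy, g.leviCivita.zero]
  rfl

lemma curvature_eventually_zero (h : (∀ᶠ y in 𝓝 x, X y = 0) ∨ (∀ᶠ y in 𝓝 x, Y y = 0) ∨
    ∀ᶠ y in 𝓝 x, Z y = 0) : ∀ᶠ y in 𝓝 x, g.curvature X Y Z y = 0 := by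
  have key : (∀ᶠ y in 𝓝 x, g.nabla X (g.nabla Y Z) y = 0) ∧
      (∀ᶠ y in 𝓝 x, g.nabla Y (g.nabla X Z) y = 0) ∧
      ∀ᶠ y in 𝓝 x, g.nabla (mlieBracket (𝓡 (m + 2)) X Y) Z y = 0 := by
    rcases h with h | h | h
    · have hb := Filter.EventuallyEq.mlieBracket_vectorField (I := 𝓡 (m + 2)) (V₁ := X) (V := 0)
        h (Filter.EventuallyEq.refl _ Y)
      rw [mlieBracket_zero_left] at hb
      exact ⟨g.nabla_eventually_zero_left h,
        g.nabla_eventually_zero_right (g.nabla_eventually_zero_left h),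
        g.nabla_eventually_zero_left hb⟩
    · have hb := Filter.EventuallyEq.mlieBracket_vectorField (I := 𝓡 (m + 2)) (W₁ := Y) (W := 0)
        (Filter.EventuallyEq.refl _ X) h
      rw [mlieBracket_zero_right] at hb
      exact ⟨g.nabla_eventually_zero_right (g.nabla_eventually_zero_left h),
        g.nabla_eventually_zero_left h, g.nabla_eventually_zero_left hb⟩
    · exact ⟨g.nabla_eventually_zero_right (g.nabla_eventually_zero_right h),
        g.nabla_eventually_zero_right (g.nabla_eventually_zero_right h),
        g.nabla_eventually_zero_right h⟩
  filter_upwards [key.1, key.2.1, key.2.2] with y h1 h2 h3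
  simp [curvature, h1, h2, h3]

/-- The tensor operation `T` vanishes at every point near which one of its arguments vanishes. -/
def _root_.TensorOp.VanishesLocally {k : ℕ} (T : TensorOp m M k) : Prop :=
  ∀ (X : Fin k → VField m M) (x : M) (i : Fin k), (∀ᶠ y in 𝓝 x, X i y = 0) → T X x = 0

lemma riem_vanishesLocally : g.riem.VanishesLocally := by
  intro X x i h
  have hc (hi : i ≠ 3) : g.curvature (X 0) (X 1) (X 2) x = 0 := by
    refine (g.curvature_eventually_zero ?_).self_of_nhds
    fin_cases i
    exacts [Or.inl h, Or.inr (Or.inl h), Or.inr (Or.inr h), absurd rfl hi]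
  by_cases hi : i = 3
  · subst hi
    simp [riem, pair, h.self_of_nhds]
  · simp [riem, pair, hc hi]

/-- This weak form of tensoriality passes through `∇` with no smoothness of the arguments. It
suffices for the curvature, because the fields `∇_ℓ e_a` to be inserted vanish on a whole open set.
-/
lemma covDeriv_vanishesLocally {k : ℕ} {T : TensorOp m M k} (hT : T.VanishesLocally) :
    (g.covDeriv T).VanishesLocally := by
  intro X x i h
  have hsum (j : Fin k) (hj : i = Fin.last k ∨ ∃ i' : Fin k, i = i'.castSucc) :
      T (Function.update (fun j : Fin k ↦ X j.castSucc) j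
        (g.nabla (X (Fin.last k)) (X j.castSucc))) x = 0 := by
    rcases hj with rfl | ⟨i, rfl⟩
    · exact hT _ x j (by simpa using g.nabla_eventually_zero_left h)
    · by_cases hij : i = j
      · subst hij
        exact hT _ x i (by simpa using g.nabla_eventually_zero_right h)
      · exact hT _ x i (by simpa [hij] using h)
  rw [covDeriv, Finset.sum_eq_zero fun j _ ↦ hsum j (i.eq_castSucc_or_eq_last.symm.imp_right id),
    sub_zero]
  rcases i.eq_castSucc_or_eq_last with ⟨i, rfl⟩ | rfl
  · have h0 : T (fun i ↦ X i.castSucc) =ᶠ[𝓝 x] 0 :=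
      h.eventually_nhds.mono fun y hy ↦ hT _ y i hy
    obtain ⟨U, hU, hUo, hxU⟩ := mem_nhds_iff.1 h0
    exact derivAlong_eq_zero (X := X (Fin.last k)) hUo hU hxU
  · simp [h.self_of_nhds]

lemma riemDeriv_vanishesLocally (N : ℕ) : (g.riemDeriv N).VanishesLocally := by
  induction N with
  | zero => exact g.riem_vanishesLocally
  | succ N ih => exact g.covDeriv_vanishesLocally ih

end LorentzMetric

end Locality

/-! ### Null frames, boost weights and connection coefficients. -/

section Frames

variable {m : ℕ} {M : Type*} [TopologicalSpace M] [ChartedSpace (EuclideanSpace ℝ (Fin (m + 2))) M]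
  [IsManifold (𝓡 (m + 2)) ∞ M] {g : LorentzMetric m M} {k : VField m M} {U : Set M}
  {e : Fin (m + 2) → VField m M} {x : M}

/-- The boost weight of a single frame index. -/
def indexWeight (a : Fin (m + 2)) : ℤ := if a = 0 then 1 else if a = 1 then -1 else 0

/-- The index dual to a frame index, exchanging the two null directions. -/
def dualIndex : Equiv.Perm (Fin (m + 2)) := Equiv.swap 0 1

@[simp] lemma dualIndex_zero : dualIndex (0 : Fin (m + 2)) = 1 := Equiv.swap_apply_left ..

@[simp] lemma dualIndex_one : dualIndex (1 : Fin (m + 2)) = 0 := Equiv.swap_apply_right ..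

@[simp] lemma indexWeight_zero : indexWeight (0 : Fin (m + 2)) = 1 := if_pos rfl

@[simp] lemma indexWeight_one : indexWeight (1 : Fin (m + 2)) = -1 := by simp [indexWeight]

@[simp] lemma indexWeight_succ_succ (i : Fin m) : indexWeight i.succ.succ = 0 := by
  simp [indexWeight, Fin.ext_iff]

@[simp] lemma dualIndex_succ_succ (i : Fin m) : dualIndex i.succ.succ = i.succ.succ :=
  Equiv.swap_apply_of_ne_of_ne (by simp [Fin.ext_iff]) (by simp [Fin.ext_iff])

lemma index_cases {p : Fin (m + 2) → Prop} (h0 : p 0) (h1 : p 1) (h : ∀ i : Fin m, p i.succ.succ)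
    (a : Fin (m + 2)) : p a :=
  Fin.cases h0 (Fin.cases h1 h) a

@[simp] lemma indexWeight_dualIndex (a : Fin (m + 2)) :
    indexWeight (dualIndex a) = -indexWeight a := by
  induction a using index_cases <;> simp

lemma boostWeight_eq {p : ℕ} (a : Fin p → Fin (m + 2)) :
    boostWeight a = ∑ j, indexWeight (a j) := rfl

lemma boostWeight_update {p : ℕ} (a : Fin p → Fin (m + 2)) (i : Fin p) (c : Fin (m + 2)) :
    boostWeight (Function.update a i c) = boostWeight a - indexWeight (a i) + indexWeight c := by
  have h (j : Fin p) : indexWeight (Function.update a i c j) =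
      Function.update (fun j ↦ indexWeight (a j)) i (indexWeight c) j := by
    by_cases hj : j = i
    · subst hj; simp
    · simp [hj]
  rw [boostWeight_eq, boostWeight_eq, Finset.sum_congr rfl fun j _ ↦ h j,
    Finset.sum_update_of_mem (Finset.mem_univ i),
    ← Finset.add_sum_erase Finset.univ (fun j ↦ indexWeight (a j)) (Finset.mem_univ i),
    Finset.sdiff_singleton_eq_erase]
  ring

namespace LorentzMetric.IsNullFrameOn

lemma gram_eq (he : g.IsNullFrameOn k U e) (hx : x ∈ U) (a b : Fin (m + 2)) :
    g.val x (e a x) (e b x) = if b = dualIndex a then 1 else 0 := by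
  rw [he.gram a b x hx]
  induction a using index_cases with
  | h0 => simp
  | h1 => simp
  | h i =>
    simp only [dualIndex_succ_succ, eq_comm (a := b)]
    simp [Fin.ext_iff]

/-- The metrically dual frame is the frame itself with `ℓ` and `n` exchanged; the Gram relations
give independence, and a dimension count gives spanning. -/
lemma frame_expansion (he : g.IsNullFrameOn k U e) (hx : x ∈ U)
    (v : TangentSpace (𝓡 (m + 2)) x) : v = ∑ c, g.val x v (e (dualIndex c) x) • e c x := by
  have coef (c : Fin (m + 2) → ℝ) (b : Fin (m + 2)) :
      g.val x (∑ a, c a • e a x) (e (dualIndex b) x) = c b := by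
    simp [he.gram_eq hx]
  have li : LinearIndependent ℝ fun a ↦ e a x := by
    rw [Fintype.linearIndependent_iff]
    intro c hc b
    rw [← coef c b, hc]
    simp
  have hcard : Fintype.card (Fin (m + 2)) = Module.finrank ℝ (TangentSpace (𝓡 (m + 2)) x) :=
    (Module.finrank_eq_card_basis (g.orthoBasis x)).symm
  obtain ⟨c, hc⟩ : ∃ c : Fin (m + 2) → ℝ, v = ∑ a, c a • e a x := by
    refine ⟨fun a ↦ (basisOfLinearIndependentOfCardEqFinrank li hcard).repr v a, ?_⟩
    conv_lhs => rw [← (basisOfLinearIndependentOfCardEqFinrank li hcard).sum_repr v]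
    simp
  conv_lhs => rw [hc]
  refine Finset.sum_congr rfl fun b _ ↦ ?_
  rw [hc, coef]

end LorentzMetric.IsNullFrameOn

lemma LorentzMetric.pair_smoothOn (g : LorentzMetric m M) {X Y : VField m M}
    (hX : VSmoothOn X U) (hY : VSmoothOn Y U) : FSmoothOn m (g.pair X Y) U := by
  have := ContMDiffOn.clm_bundle_apply₂ (F₁ := EuclideanSpace ℝ (Fin (m + 2)))
    (F₂ := EuclideanSpace ℝ (Fin (m + 2))) (F₃ := ℝ) (E₃ := fun _ : M ↦ ℝ)
    g.contMDiff.contMDiffOn hX hY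
  intro x hx
  simpa [contMDiffWithinAt_section] using! this x hx

lemma LorentzMetric.koszul_smoothOn (g : LorentzMetric m M) (hU : IsOpen U) {X Y Z : VField m M}
    (hX : VSmoothOn X U) (hY : VSmoothOn Y U) (hZ : VSmoothOn Z U) :
    FSmoothOn m (g.koszul Y X Z) U := by
  have h1 := (g.pair_smoothOn hY hZ).derivAlong hX hU
  have h2 := (g.pair_smoothOn hX hZ).derivAlong hY hU
  have h3 := (g.pair_smoothOn hX hY).derivAlong hZ hU
  have h4 := g.pair_smoothOn (hX.mlieBracket hY hU) hZ
  have h5 := g.pair_smoothOn (hX.mlieBracket hZ hU) hY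
  have h6 := g.pair_smoothOn (hY.mlieBracket hZ hU) hX
  refine ((((((h1.add h2).sub h3).add h4).sub h5).sub h6).mul
    (contMDiffOn_const (c := (2 : ℝ)⁻¹))).congr fun x _ ↦ ?_
  simp only [koszul, div_eq_mul_inv]
  rfl

/-- The connection coefficient `g(∇_{e b} e_a, e_c)` of a frame. -/
def LorentzMetric.connCoeff (g : LorentzMetric m M) (e : Fin (m + 2) → VField m M)
    (c a b : Fin (m + 2)) : M → ℝ :=
  g.pair (g.nabla (e b) (e a)) (e c)

namespace LorentzMetric.IsNullFrameOn

/-- The connection is built point by point, so smoothness is read off from the Koszul formula. -/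
lemma connCoeff_smoothOn (he : g.IsNullFrameOn k U e) (c a b : Fin (m + 2)) :
    FSmoothOn m (g.connCoeff e c a b) U :=
  (g.koszul_smoothOn he.isOpen (he.smooth b) (he.smooth a) (he.smooth c)).congr fun _ hx ↦
    g.val_leviCivita ((he.smooth b).vDiffAt he.isOpen hx) ((he.smooth a).vDiffAt he.isOpen hx)
      ((he.smooth c).vDiffAt he.isOpen hx)

lemma nabla_eq (he : g.IsNullFrameOn k U e) (a b : Fin (m + 2)) (hx : x ∈ U) :
    g.nabla (e b) (e a) x = ∑ c, g.connCoeff e (dualIndex c) a b x • e c x :=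
  he.frame_expansion hx _

lemma nabla_smoothOn (he : g.IsNullFrameOn k U e) (a b : Fin (m + 2)) :
    VSmoothOn (g.nabla (e b) (e a)) U := by
  have h := ContMDiffOn.sum_section (I := 𝓡 (m + 2)) (s := Finset.univ)
    (t := fun c ↦ g.connCoeff e (dualIndex c) a b • e c) (u := U) (n := ∞)
    (F := EuclideanSpace ℝ (Fin (m + 2))) (V := (TangentSpace (𝓡 (m + 2)) : M → Type _))
    fun c _ ↦ (he.connCoeff_smoothOn (dualIndex c) a b).smul_section (he.smooth c)
  refine h.congr fun x hx ↦ ?_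
  rw [he.nabla_eq a b hx]
  rfl

/-- The scalar products of frame vectors are constant; differentiate them using metric
compatibility. -/
lemma connCoeff_antisymm (he : g.IsNullFrameOn k U e) (c a b : Fin (m + 2)) (hx : x ∈ U) :
    g.connCoeff e c a b x = -g.connCoeff e a c b x := by
  have h := g.leviCivita_metric ((he.smooth b).vDiffAt he.isOpen hx)
    ((he.smooth a).vDiffAt he.isOpen hx) ((he.smooth c).vDiffAt he.isOpen hx)
  have h0 : mvfderiv (𝓡 (m + 2)) (g.pair (e a) (e c)) x (e b x) = 0 := by
    refine (derivAlong_congr (X := e b) he.isOpen (fun y hy ↦ he.gram_eq hy a c) hx).trans ?_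
    rw [derivAlong, mvfderiv_const]
    rfl
  rw [h0, g.symm x (e a x)] at h
  exact eq_neg_of_add_eq_zero_left h.symm

lemma connCoeff_self (he : g.IsNullFrameOn k U e) (a b : Fin (m + 2)) (hx : x ∈ U) :
    g.connCoeff e a a b x = 0 := by
  linarith [he.connCoeff_antisymm a a b hx]

lemma frame_zero_ne_zero (he : g.IsNullFrameOn k U e) (hx : x ∈ U) : e 0 x ≠ 0 := by
  intro h
  simpa [h] using he.gram_eq hx 0 1

end LorentzMetric.IsNullFrameOn

/-! ### Commutators and structure equations in a parallel frame. -/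

namespace LorentzMetric.IsParallelNullFrameOn

lemma connCoeff_zero (he : g.IsParallelNullFrameOn k U e) (c a : Fin (m + 2)) (hx : x ∈ U) :
    g.connCoeff e c a 0 x = 0 := by
  simp [connCoeff, pair, he.parallel a x hx]

lemma mlieBracket_eq (he : g.IsParallelNullFrameOn k U e) (b : Fin (m + 2)) (hx : x ∈ U) :
    mlieBracket (𝓡 (m + 2)) (e 0) (e b) x = -g.nabla (e b) (e 0) x := by
  rw [← (CovariantDerivative.torsion_eq_zero_iff _).1 g.leviCivita_torsion
    ((he.smooth 0).vDiffAt he.isOpen hx) ((he.smooth b).vDiffAt he.isOpen hx)]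
  have := he.parallel b x hx
  rw [nabla] at this
  rw [this, zero_sub]
  rfl

/-- Vanishing torsion and `∇_ℓ e_b = 0` give `[ℓ, e_b] = -∇_{e_b} ℓ`, which is then expanded in the
frame. -/
lemma derivAlong_commute (he : g.IsParallelNullFrameOn k U e) (b : Fin (m + 2)) {f : M → ℝ}
    (hf : FSmoothOn m f U) (hx : x ∈ U) :
    derivAlong (e 0) (derivAlong (e b) f) x = derivAlong (e b) (derivAlong (e 0) f) x -
      ∑ d, g.connCoeff e (dualIndex d) 0 b x * derivAlong (e d) f x := by
  have h := derivAlong_mlieBracket he.isOpen (he.smooth 0) (he.smooth b) (he.smooth 0) hf hx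
    (he.frame_zero_ne_zero hx)
  rw [derivAlong, he.mlieBracket_eq b hx, he.nabla_eq 0 b hx] at h
  simp only [map_neg, map_sum, map_smul, smul_eq_mul] at h
  simp only [derivAlong] at h ⊢
  linarith

/-- In `R(ℓ, e_b) e_a` the term `∇_{e_b} ∇_ℓ e_a` drops out and the bracket term produces the
quadratic sum. As `e_c` is parallel, what remains is the `D`-derivative of the coefficient. -/
lemma derivAlong_connCoeff (he : g.IsParallelNullFrameOn k U e) (c a b : Fin (m + 2))
    (hx : x ∈ U) :
    derivAlong (e 0) (g.connCoeff e c a b) x = frameComponent g.riem e ![0, b, a, c] x -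
      ∑ d, g.connCoeff e (dualIndex d) 0 b x * g.connCoeff e c a d x := by
  have h := g.leviCivita_metric ((he.smooth 0).vDiffAt he.isOpen hx)
    ((he.nabla_smoothOn a b).vDiffAt he.isOpen hx) ((he.smooth c).vDiffAt he.isOpen hx)
  have hc : g.leviCivita (e c) x (e 0 x) = 0 := he.parallel c x hx
  have h2 : g.nabla (e b) (g.nabla (e 0) (e a)) x = 0 :=
    (g.nabla_eventually_zero_right
      (Filter.eventually_of_mem (he.isOpen.mem_nhds hx) (he.parallel a))).self_of_nhds
  have h3 : g.nabla (mlieBracket (𝓡 (m + 2)) (e 0) (e b)) (e a) x =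
      -∑ d, g.connCoeff e (dualIndex d) 0 b x • g.nabla (e d) (e a) x := by
    rw [nabla, he.mlieBracket_eq b hx, he.nabla_eq 0 b hx]
    simp only [map_neg, map_sum, map_smul]
    rfl
  have h4 : frameComponent g.riem e ![0, b, a, c] x =
      g.val x (g.nabla (e 0) (g.nabla (e b) (e a)) x) (e c x) +
        ∑ d, g.connCoeff e (dualIndex d) 0 b x * g.connCoeff e c a d x := by
    change g.val x (g.nabla (e 0) (g.nabla (e b) (e a)) x - g.nabla (e b) (g.nabla (e 0) (e a)) x -
      g.nabla (mlieBracket (𝓡 (m + 2)) (e 0) (e b)) (e a) x) (e c x) = _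
    rw [h2, h3]
    simp [connCoeff, pair, map_sum]
  rw [hc, map_zero, add_zero] at h
  rw [h4, add_sub_cancel_right]
  exact h

/-- All correction terms contain some `∇_ℓ e_a`, which is zero on `U`. -/
lemma frameComponent_covDeriv_snoc_zero (he : g.IsParallelNullFrameOn k U e) {p : ℕ}
    {T : TensorOp m M p} (hT : T.VanishesLocally) (a : Fin p → Fin (m + 2)) (hx : x ∈ U) :
    frameComponent (g.covDeriv T) e (Fin.snoc (α := fun _ ↦ Fin (m + 2)) a 0) x =
      derivAlong (e 0) (frameComponent T e a) x := by
  simp only [frameComponent, covDeriv, Fin.snoc_castSucc, Fin.snoc_last]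
  rw [Finset.sum_eq_zero, sub_zero]
  · rfl
  · intro i _
    refine hT _ x i ?_
    simpa using Filter.eventually_of_mem (he.isOpen.mem_nhds hx) (he.parallel (a i))

lemma exists_riemDeriv (he : g.IsParallelNullFrameOn k U e) (a : Fin 4 → Fin (m + 2)) (N : ℕ) :
    ∃ a' : Fin (4 + N) → Fin (m + 2), boostWeight a' = boostWeight a + N ∧ ∀ x ∈ U,
      frameComponent (g.riemDeriv N) e a' x =
        (derivAlong (e 0))^[N] (frameComponent g.riem e a) x := by
  induction N with
  | zero => exact ⟨a, by simp, fun _ _ ↦ rfl⟩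
  | succ N ih =>
    obtain ⟨a', hw, h⟩ := ih
    refine ⟨Fin.snoc (α := fun _ ↦ Fin (m + 2)) a' 0, ?_, fun x hx ↦ ?_⟩
    · have : boostWeight (Fin.snoc (α := fun _ ↦ Fin (m + 2)) a' 0) = boostWeight a' + 1 := by
        simp only [boostWeight_eq, Fin.sum_univ_castSucc, Fin.snoc_castSucc, Fin.snoc_last,
          indexWeight_zero]
      refine this.trans ?_
      rw [hw]
      push_cast
      ring
    · rw [Function.iterate_succ_apply']
      exact (he.frameComponent_covDeriv_snoc_zero (g.riemDeriv_vanishesLocally N) a' hx).trans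
        (derivAlong_congr he.isOpen h hx)

end LorentzMetric.IsParallelNullFrameOn

end Frames

/-! ### Degree bounds from the Kundt and degeneracy conditions. -/

section Balance

variable {m : ℕ} {M : Type*} [TopologicalSpace M] [ChartedSpace (EuclideanSpace ℝ (Fin (m + 2))) M]
  [IsManifold (𝓡 (m + 2)) ∞ M] {g : LorentzMetric m M} {k : VField m M} {U : Set M}
  {e : Fin (m + 2) → VField m M} {x : M}

namespace LorentzMetric.IsParallelNullFrameOn

/-- Parallel transport settles `b = 0`. For other `b`, positive weight leaves only the coefficients
with `a = c = 0`, zero by antisymmetry, and the spatial `L_ij` up to sign, zero by the Kundt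
condition. -/
lemma connCoeff_eq_zero (he : g.IsParallelNullFrameOn k U e) (hg : g.IsKundt k)
    (c a b : Fin (m + 2)) (hw : 1 ≤ indexWeight a + indexWeight b + indexWeight c) (hx : x ∈ U) :
    g.connCoeff e c a b x = 0 := by
  have hself (a b : Fin (m + 2)) := he.connCoeff_self a b hx
  have hK (i j : Fin m) : g.connCoeff e i.succ.succ 0 j.succ.succ x = 0 :=
    hg.rot_spatial U e he.toIsNullFrameOn i j x hx
  have hK' (i j : Fin m) : g.connCoeff e 0 i.succ.succ j.succ.succ x = 0 := by
    rw [he.connCoeff_antisymm _ _ _ hx, hK, neg_zero]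
  induction b using index_cases with
  | h0 => exact he.connCoeff_zero c a hx
  | h1 =>
    induction a using index_cases <;> induction c using index_cases <;> simp_all
  | h j =>
    induction a using index_cases <;> induction c using index_cases <;> simp_all

lemma riem_nilpotent (he : g.IsParallelNullFrameOn k U e) (hg : g.IsDegenerateKundt k)
    (a : Fin 4 → Fin (m + 2)) {N : ℕ} (hN : 0 < boostWeight a + N) :
    ∀ x ∈ U, (derivAlong (e 0))^[N] (frameComponent g.riem e a) x = 0 := by
  obtain ⟨a', hw, h⟩ := he.exists_riemDeriv a N
  intro x hx
  rw [← h x hx]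
  exact hg.typeII N U e he.toIsNullFrameOn a' (hw ▸ hN) x hx

/-- One integration of the structure equation: once the quadratic terms obey the bound, so does the
coefficient, with the order raised by one. -/
lemma nilAlong_connCoeff_of_mul (he : g.IsParallelNullFrameOn k U e) (hg : g.IsDegenerateKundt k)
    (c a b : Fin (m + 2)) (h : ∀ d, NilAlong U (e 0)
      (-(indexWeight a + indexWeight b + indexWeight c)).toNat
      (g.connCoeff e (dualIndex d) 0 b * g.connCoeff e c a d)) :
    NilAlong U (e 0) (1 - (indexWeight a + indexWeight b + indexWeight c)).toNat
      (g.connCoeff e c a b) := by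
  have hU := he.isOpen
  have hℓ := he.smooth 0
  rcases le_or_gt 1 (indexWeight a + indexWeight b + indexWeight c) with hw | hw
  · exact .of_eq_zero hU fun x hx ↦ he.connCoeff_eq_zero hg.toIsKundt c a b hw hx
  rw [show (1 - (indexWeight a + indexWeight b + indexWeight c)).toNat =
    (-(indexWeight a + indexWeight b + indexWeight c)).toNat + 1 by omega]
  have hsum := NilAlong.sum (s := Finset.univ) (fun d _ ↦ h d) hU hℓ
  have hΓ := he.connCoeff_smoothOn c a b
  have hR : NilAlong U (e 0) (-(indexWeight a + indexWeight b + indexWeight c)).toNat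
      (frameComponent g.riem e ![0, b, a, c]) := by
    -- Smoothness of the curvature component comes from solving the structure equation for it.
    refine ⟨((hΓ.derivAlong hℓ hU).add hsum.smooth).congr fun x hx ↦ ?_,
      he.riem_nilpotent hg _ ?_⟩
    · simp [he.derivAlong_connCoeff c a b hx]
    -- The extra index `0` gives this component weight `1 + w`, so `-w` derivatives along `ℓ`
    -- already reach positive weight.
    · simp only [boostWeight_eq, Fin.sum_univ_four]
      simp
      omega
  refine (NilAlong.succ_iff hU hℓ).2 ⟨hΓ, (hR.sub hsum hU hℓ).congr hU fun x hx ↦ ?_⟩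
  rw [he.derivAlong_connCoeff c a b hx]
  simp

/-- The connection coefficients of a parallel frame along the Kundt direction are polynomial in
the affine parameter, of degree at most minus their boost weight. -/
lemma nilAlong_connCoeff (he : g.IsParallelNullFrameOn k U e) (hg : g.IsDegenerateKundt k)
    (c a b : Fin (m + 2)) :
    NilAlong U (e 0) (1 - (indexWeight a + indexWeight b + indexWeight c)).toNat
      (g.connCoeff e c a b) := by
  have hU := he.isOpen
  have hℓ := he.smooth 0
  have left {c a b d : Fin (m + 2)} {n : ℕ} (h : indexWeight d ≤ indexWeight b) :
      NilAlong U (e 0) n (g.connCoeff e (dualIndex d) 0 b * g.connCoeff e c a d) :=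
    .of_eq_zero hU fun x hx ↦ by
      simp [he.connCoeff_eq_zero hg.toIsKundt (dualIndex d) 0 b (by simp; omega) hx]
  have right {c a b : Fin (m + 2)} {n : ℕ} :
      NilAlong U (e 0) n (g.connCoeff e (dualIndex 0) 0 b * g.connCoeff e c a 0) :=
    .of_eq_zero hU fun x hx ↦ by simp [he.connCoeff_zero c a hx]
  -- For a spatial derivative index every quadratic term vanishes: its second factor if `d = 0`, its
  -- first, of positive weight, otherwise.
  have spatial (c a : Fin (m + 2)) (j : Fin m) := by
    refine he.nilAlong_connCoeff_of_mul hg c a j.succ.succ fun d ↦ ?_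
    induction d using index_cases with
    | h0 => exact right
    | h1 => exact left (by simp)
    | h i => exact left (by simp)
  -- For `L_{i1}` the remaining terms contain `L_{ij}`, which is zero; this coefficient must be
  -- bounded before the general case `b = 1`.
  have rot (i : Fin m) := by
    refine he.nilAlong_connCoeff_of_mul hg i.succ.succ 0 1 fun d ↦ ?_
    induction d using index_cases with
    | h0 => exact right
    | h1 => exact left le_rfl
    | h j =>
      refine .of_eq_zero hU fun x hx ↦ ?_
      simp [he.connCoeff_eq_zero hg.toIsKundt i.succ.succ 0 j.succ.succ (by simp) hx]
  induction b using index_cases with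
  | h0 => exact .of_eq_zero hU fun x hx ↦ he.connCoeff_zero c a hx
  | h j => exact spatial c a j
  | h1 =>
    refine he.nilAlong_connCoeff_of_mul hg c a 1 fun d ↦ ?_
    induction d using index_cases with
    | h0 => exact right
    | h1 => exact left (by simp)
    | h j =>
      -- The only surviving products: `L_{j1}`, of order one, times a coefficient bounded in
      -- `spatial`.
      rw [dualIndex_succ_succ]
      exact (rot j).mul (spatial c a j) hU hℓ (by simp; omega)

/-- Apply `D` to `e_b f` and commute: `D f` has smaller order, and the commutator involves only `e_c
f` with `c` of larger weight than `b`. -/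
lemma nilAlong_derivAlong (he : g.IsParallelNullFrameOn k U e) (hg : g.IsDegenerateKundt k)
    (b : Fin (m + 2)) {d : ℤ} {f : M → ℝ} (hf : NilAlong U (e 0) d.toNat f) :
    NilAlong U (e 0) (d - indexWeight b).toNat (derivAlong (e b) f) := by
  have hU := he.isOpen
  have hℓ := he.smooth 0
  -- The induction measure drops both when `d` decreases and when the weight of the index increases.
  have main (n : ℕ) : ∀ (b : Fin (m + 2)) (f : M → ℝ) (d : ℤ), NilAlong U (e 0) d.toNat f →
      d.toNat + (1 - indexWeight b).toNat = n →
      NilAlong U (e 0) (d - indexWeight b).toNat (derivAlong (e b) f) := by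
    induction n using Nat.strong_induction_on with
    | _ n ih =>
    intro b f d hf hn
    rcases le_or_gt d 0 with hd | hd
    · rw [Int.toNat_of_nonpos hd] at hf
      exact .of_eq_zero hU fun x hx ↦ derivAlong_eq_zero hU hf.eq_zero hx
    have hf' : NilAlong U (e 0) (d - 1).toNat (derivAlong (e 0) f) :=
      ((NilAlong.succ_iff hU hℓ).1 (by rwa [show (d - 1).toNat + 1 = d.toNat by omega])).2
    by_cases hb : b = 0
    · subst hb
      simpa using hf'
    have hwb : indexWeight b ≤ 0 := by
      simp only [indexWeight, hb, if_false]
      split_ifs <;> simp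
    have h1 := ih _ (by omega) b _ _ hf' rfl
    have h2 (c : Fin (m + 2)) : NilAlong U (e 0) (d - 1 - indexWeight b).toNat
        (g.connCoeff e (dualIndex c) 0 b * derivAlong (e c) f) := by
      have hΓ := he.nilAlong_connCoeff hg (dualIndex c) 0 b
      rcases le_or_gt (indexWeight c) (indexWeight b) with hc | hc
      · exact .of_eq_zero hU fun x hx ↦ by
          simp [he.connCoeff_eq_zero hg.toIsKundt (dualIndex c) 0 b (by simp; omega) hx]
      · exact hΓ.mul (ih _ (by omega) c _ _ hf rfl) hU hℓ (by simp; omega)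
    rw [show (d - indexWeight b).toNat = (d - 1 - indexWeight b).toNat + 1 by omega]
    refine (NilAlong.succ_iff hU hℓ).2 ⟨hf.smooth.derivAlong (he.smooth b) hU,
      (h1.sub (NilAlong.sum (s := Finset.univ) (fun c _ ↦ h2 c) hU hℓ) hU hℓ).congr hU
        fun x hx ↦ ?_⟩
    rw [he.derivAlong_commute b hf.smooth hx]
    simp
  exact main _ b f d hf rfl

end LorentzMetric.IsParallelNullFrameOn

/-- Truncation by `toNat` merges the two clauses: for `b ≥ -1` the order is zero, which means
vanishing. -/
lemma isOneBalancedScalarOn_iff {ℓ : VField m M} {b : ℤ} {η : M → ℝ} (hη : FSmoothOn m η U) :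
    IsOneBalancedScalarOn U ℓ b η ↔ NilAlong U ℓ (-b - 1).toNat η := by
  constructor
  · intro h
    refine ⟨hη, ?_⟩
    rcases lt_or_ge b (-1) with hb | hb
    · exact h.of_lt hb
    · rw [Int.toNat_of_nonpos (by omega)]
      exact h.of_ge hb
  · intro h
    refine ⟨fun _ ↦ h.eq_zero, fun hb ↦ ?_⟩
    have := h.eq_zero
    rwa [Int.toNat_of_nonpos (by omega)] at this

/-- The frame components of a covariant derivative in terms of those of the tensor field. -/
lemma IsTensorField.frameComponent_covDeriv {p : ℕ} {T : TensorOp m M p} (hT : IsTensorField T)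
    (he : g.IsNullFrameOn k U e) (a : Fin (p + 1) → Fin (m + 2)) (hx : x ∈ U) :
    frameComponent (g.covDeriv T) e a x =
      derivAlong (e (a (Fin.last p))) (frameComponent T e fun j ↦ a j.castSucc) x -
      ∑ i : Fin p, ∑ c, g.connCoeff e (dualIndex c) (a i.castSucc) (a (Fin.last p)) x *
        frameComponent T e (Function.update (fun j : Fin p ↦ a j.castSucc) i c) x := by
  rw [frameComponent, LorentzMetric.covDeriv]
  congr 1
  refine Finset.sum_congr rfl fun i _ ↦ ?_
  obtain ⟨t, ht⟩ := hT.pointwise x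
  rw [ht U _ he.isOpen hx fun j ↦ by
    by_cases hj : j = i
    · subst hj
      simpa using he.nabla_smoothOn _ _
    · simpa [hj] using he.smooth _]
  have hupd (Y : VField m M) : (fun j ↦ Function.update (fun j : Fin p ↦ e (a j.castSucc)) i Y j x) =
      Function.update (fun j : Fin p ↦ e (a j.castSucc) x) i (Y x) := by
    funext j
    by_cases hj : j = i
    · subst hj
      simp
    · simp [hj]
  rw [hupd, he.nabla_eq _ _ hx, MultilinearMap.map_update_sum]
  refine Finset.sum_congr rfl fun c _ ↦ ?_
  rw [MultilinearMap.map_update_smul, smul_eq_mul, frameComponent,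
    ht U _ he.isOpen hx fun j ↦ he.smooth _, ← hupd]
  congr 2
  funext j
  by_cases hj : j = i
  · subst hj
    simp
  · simp [hj]

end Balance

end

theorem lemmaA7 {m : ℕ} {M : Type*} [TopologicalSpace M]
    [ChartedSpace (EuclideanSpace ℝ (Fin (m + 2))) M] [IsManifold (𝓡 (m + 2)) ∞ M]
    (g : LorentzMetric m M) (k : VField m M) (hg : g.IsDegenerateKundt k)
    {p : ℕ} (T : TensorOp m M p) (hT : IsTensorField T)
    (U : Set M) (e : Fin (m + 2) → VField m M) (he : g.IsParallelNullFrameOn k U e)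
    (hbal : IsOneBalancedOn U e T) :
    IsOneBalancedOn U e (g.covDeriv T) := by
  have hU := he.isOpen
  have hℓ := he.smooth 0
  have hN (a : Fin p → Fin (m + 2)) :
      NilAlong U (e 0) (-boostWeight a - 1).toNat (frameComponent T e a) :=
    (isOneBalancedScalarOn_iff (hT.smooth U _ hU fun j ↦ he.smooth _)).1 (hbal a)
  intro a
  have hw : boostWeight a =
      boostWeight (fun j : Fin p ↦ a j.castSucc) + indexWeight (a (Fin.last p)) := by
    simp only [boostWeight_eq, Fin.sum_univ_castSucc]
  have h1 := he.nilAlong_derivAlong hg (a (Fin.last p)) (hN fun j ↦ a j.castSucc)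
  -- Replacing an index of `T` by `c` changes its weight by what the coefficient compensates, so
  -- every product has the total weight of the component of `∇T`. The orders `1 - w` and `-b' - 1`
  -- then combine to `-(w + b') - 1`.
  have h2 (i : Fin p) (c : Fin (m + 2)) :=
    (he.nilAlong_connCoeff hg (dualIndex c) (a i.castSucc) (a (Fin.last p))).mul
      (hN (Function.update (fun j : Fin p ↦ a j.castSucc) i c)) hU hℓ
      (c := -boostWeight (fun j : Fin p ↦ a j.castSucc) - 1 - indexWeight (a (Fin.last p)))
      (by rw [boostWeight_update, indexWeight_dualIndex]; omega)
  have h3 := h1.sub (NilAlong.sum (s := Finset.univ) (fun i _ ↦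
    NilAlong.sum (s := Finset.univ) (fun c _ ↦ h2 i c) hU hℓ) hU hℓ) hU hℓ
  have h4 := h3.congr hU (h := frameComponent (g.covDeriv T) e a) fun x hx ↦ by
    rw [hT.frameComponent_covDeriv he.toIsNullFrameOn a hx]
    simp
  refine (isOneBalancedScalarOn_iff h4.smooth).2 ?_
  rwa [hw, show -(boostWeight (fun j : Fin p ↦ a j.castSucc) + indexWeight (a (Fin.last p))) - 1 =
    -boostWeight (fun j : Fin p ↦ a j.castSucc) - 1 - indexWeight (a (Fin.last p)) by ring]
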